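/- Let $M$ be a finite simple matroid with ground set $\{a_1,\dots,a_n\}$ and lattice of flats $\mathcal L_M$ (ordered by inclusion; its atoms are identified with the $a_i$). For $A\subseteq[n]$ let $e_A\in\{0,1\}^n$ be its incidence vector. *Bergman fan.* Let $P_M\subset\mathbb R^n$ be the matroid polytope, the convex hull of the vectors $e_B$ for $B$ a basis of $M$. For $\omega\in\mathbb R^n$ the matroid type $M_\omega$ is the matroid whose bases are the bases $B$ of $M$ for which $e_B$ lies on the face of $P_M$ where $\langle\omega,\cdot\rangle$ is maximal. The cones $\overline{\{\omega' : M_{\omega'}=M_\omega\}}$, $\omega\in\mathbb R^n$, form the (outer) normal fan of $P_M$; the Bergman fan $\widetilde{\mathcal B}(M)$ is its subfan consisting of the cones for which $M_\omega$ has no loops. *Decomposition complex.* A decomposition in a finite poset $P$ is a triple $(x,z,y)$ with $x\le z\le y$ such that there is an order isomorphism $\psi:[x,z]\times[z,y]\to[x,y]$ with $\psi(u,z)=u$ and $\psi(z,v)=v$ for all $u\in[x,z]$, $v\in[z,y]$. Let $\mathcal G_{\max}$ be the set of all decompositions. For $A\subseteq P$ let $\langle A\rangle$ be the smallest $B\supseteq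 A$ such that $x,y\in B$ implies $z\in B$ for all $(x,z,y)\in\mathcal G_{\max}$. The decomposition complex is $\mathcal D(P,\mathcal G_{\max})=\{\langle C\rangle : C \text{ a non-empty chain in } P\}$. For $P=\mathcal L_M$ and the atom map $\phi(x)=\{i\in[n] : a_i\le x\}$, put $\Gamma(A)=\operatorname{conv}\{e_{\phi(x)} : x\in A\}$ and $\widetilde{\mathcal D}(\mathcal L_M,\mathcal G_{\max})=\{\Gamma(A) : A\in\mathcal D(\mathcal L_M,\mathcal G_{\max})\}$. **Proposition.** As subsets of $\mathbb R^n$ (each of $\widetilde{\mathcal B}(M)$ and $\widetilde{\mathcal D}(\mathcal L_M,\mathcal G_{\max})$ being identified with the union of its members), $$\widetilde{\mathcal B}(M)=\mathbb R_{\ge 0}\,\widetilde{\mathcal D}(\mathcal L_M,\mathcal G_{\max})+\mathbb R\,(1,\dots,1),$$ where $\mathbb R_{\ge0}X=\{cv : c\ge0,\ v\in X\}$ and $+$ is the Minkowski sum. -/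

import Mathlib

open scoped Pointwise

noncomputable section

namespace DecompositionFan

section Poset

variable {P : Type*} [PartialOrder P]

/-- `(x, z, y)` is a decomposition of the poset `P`: `x ≤ z ≤ y` (trivial decompositions are those
with `z = x` or `z = y`), and there is an isomorphism `ψ : [x, z] × [z, y] ≅ [x, y]` with
`ψ (u, z) = u` and `ψ (z, v) = v`. -/
def IsDecomposition (x z y : P) : Prop :=
  ∃ (hxz : x ≤ z) (hzy : z ≤ y) (ψ : Set.Icc x z × Set.Icc z y ≃o Set.Icc x y),
    (∀ u : Set.Icc x z, (ψ (u, ⟨z, le_rfl, hzy⟩) : P) = u) ∧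
    (∀ v : Set.Icc z y, (ψ (⟨z, hxz, le_rfl⟩, v) : P) = v)

/-- The maximal decomposition set: all decompositions of `P`. -/
def maxDecompositionSet (P : Type*) [PartialOrder P] : Set (P × P × P) :=
  {t | IsDecomposition t.1 t.2.1 t.2.2}

/-- The closure `⟨A⟩` of a subset `A` of `P` with respect to a set of decompositions. -/
def decompositionClosure (G : Set (P × P × P)) (A : Set P) : Set P :=
  ⋂₀ {B | A ⊆ B ∧ ∀ x z y : P, (x, z, y) ∈ G → x ∈ B → y ∈ B → z ∈ B}

/-- The decomposition complex: the closures of the non-empty chains of `P`. -/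
def decompositionComplex (G : Set (P × P × P)) : Set (Set P) :=
  {A | ∃ C : Set P, C.Nonempty ∧ IsChain (· ≤ ·) C ∧ A = decompositionClosure G C}

end Poset

section Realization

variable {P : Type*} [PartialOrder P] {α : Type*}

/-- The incidence vector of a subset `A` of `α`. -/
def incidenceVector (A : Set α) : α → ℝ := A.indicator 1

/-- The polytope `Γ(A)`, the convex hull of the incidence vectors of the `φ x` for `x ∈ A`. -/
def realizationPolytope (φ : P → Set α) (A : Set P) : Set (α → ℝ) :=
  convexHull ℝ ((fun x => incidenceVector (φ x)) '' A)

/-- The realization, given by `φ`, of the decomposition complex of `P` with respect to `G`: the set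
of all polytopes `Γ(A)` for `A` in the decomposition complex. -/
def complexRealization (G : Set (P × P × P)) (φ : P → Set α) : Set (Set (α → ℝ)) :=
  realizationPolytope φ '' decompositionComplex G

end Realization

section Matroid

variable {α : Type*}

/-- A matroid is simple if it has neither loops nor distinct parallel elements, that is, if all
subsets of its ground set with at most two elements are independent. -/
def IsSimpleMatroid (M : Matroid α) : Prop :=
  ∀ e ∈ M.E, ∀ f ∈ M.E, M.Indep {e, f}

/-- The lattice of flats of `M`, ordered by inclusion. -/
abbrev Flats (M : Matroid α) : Type _ := {F : Set α // M.IsFlat F}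

/-- The flat spanned by an element `i`. If `M` is simple with ground set `α`, these are the atoms of
the lattice of flats. -/
def atomFlat (M : Matroid α) (i : α) : Flats M := ⟨M.closure {i}, M.isFlat_closure {i}⟩

/-- The atom map, which sends a flat `x` to the set of all `i` whose atom lies below `x`. -/
def atomMap (M : Matroid α) (x : Flats M) : Set α := {i | atomFlat M i ≤ x}

/-- The matroid polytope: the convex hull of the incidence vectors of the bases. -/
def matroidPolytope (M : Matroid α) : Set (α → ℝ) :=
  convexHull ℝ (incidenceVector '' {B | M.IsBase B})

/-- The symmetric basis exchange property. -/
theorem exists_symmetric_exchange {M : Matroid α} {B₁ B₂ : Set α} (h₁ : M.IsBase B₁)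
    (h₂ : M.IsBase B₂) {e : α} (he : e ∈ B₁ \ B₂) :
    ∃ f ∈ B₂ \ B₁, M.IsBase (insert f (B₁ \ {e})) ∧ M.IsBase (insert e (B₂ \ {f})) := by
  have heE : e ∈ M.E := h₁.subset_ground he.1
  have hcl : e ∈ M.closure B₂ := by rw [h₂.closure_eq]; exact heE
  have hC : M.IsCircuit (M.fundCircuit e B₂) := h₂.fundCircuit_isCircuit heE he.2
  have hex : ∃ f ∈ M.fundCircuit e B₂ \ {e}, f ∉ M.closure (B₁ \ {e}) := by
    by_contra! hcon
    have h3 : M.closure (M.fundCircuit e B₂ \ {e}) ⊆ M.closure (B₁ \ {e}) :=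
      M.closure_subset_closure_of_subset_closure hcon
    have h4 := h3 (hC.mem_closure_sdiff_singleton_of_mem (M.mem_fundCircuit e B₂))
    exact h₁.indep.notMem_closure_sdiff_of_mem he.1 h4
  obtain ⟨f, ⟨hfC, hfe⟩, hf⟩ := hex
  have hfe' : f ≠ e := hfe
  have hfB₂ : f ∈ B₂ := (M.fundCircuit_subset_insert e B₂ hfC).resolve_left hfe'
  have hfB₁ : f ∉ B₁ := fun h => hf (M.mem_closure_of_mem' ⟨h, hfe⟩ (h₂.subset_ground hfB₂))
  refine ⟨f, ⟨hfB₂, hfB₁⟩, ?_, ?_⟩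
  · exact h₁.exchange_base_of_notMem_closure he.1 hf (h₂.subset_ground hfB₂)
  · have h5 := h₂.exchange_isBase_of_indep' hfB₂ he.2
      ((h₂.indep.mem_fundCircuit_iff hcl he.2).1 hfC)
    rwa [← Set.insert_sdiff_singleton_comm hfe'.symm] at h5

theorem incidenceVector_exchange {B₁ B₂ : Set α} {e f : α} (he : e ∈ B₁ \ B₂)
    (hf : f ∈ B₂ \ B₁) :
    incidenceVector (insert f (B₁ \ {e})) + incidenceVector (insert e (B₂ \ {f})) =
      incidenceVector B₁ + incidenceVector B₂ := by
  classical
  obtain ⟨he1, he2⟩ := he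
  obtain ⟨hf1, hf2⟩ := hf
  have hef : e ≠ f := fun h => hf2 (h ▸ he1)
  funext i
  by_cases h1 : i = e
  · subst h1; simp [incidenceVector, Set.indicator, he1, he2, hef]
  · by_cases h2 : i = f
    · subst h2; simp [incidenceVector, Set.indicator, hf1, hf2, h1]
    · simp [incidenceVector, Set.indicator, h1, h2]

variable [Fintype α]

/-- `B` is a basis of the matroid type of `ω`: a basis of `M` whose incidence vector lies on the
face of the matroid polytope on which the linear functional `ω` is maximal. -/
def IsTypeBase (M : Matroid α) (ω : α → ℝ) (B : Set α) : Prop :=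
  M.IsBase B ∧ ∀ v ∈ matroidPolytope M, ω ⬝ᵥ v ≤ ω ⬝ᵥ incidenceVector B

theorem exists_isTypeBase (M : Matroid α) (ω : α → ℝ) : ∃ B, IsTypeBase M ω B := by
  obtain ⟨B, hB, hmax⟩ := Set.exists_max_image {B | M.IsBase B}
    (fun B => ω ⬝ᵥ incidenceVector B) (Set.toFinite _) M.exists_isBase
  refine ⟨B, hB, fun v hv => ?_⟩
  have hconv : Convex ℝ {v : α → ℝ | ω ⬝ᵥ v ≤ ω ⬝ᵥ incidenceVector B} :=
    convex_halfSpace_le ⟨fun x y => dotProduct_add ω x y, fun c x => dotProduct_smul c ω x⟩ _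
  refine convexHull_min ?_ hconv hv
  rintro _ ⟨B', hB', rfl⟩
  exact hmax B' hB'

theorem isTypeBase_exchange (M : Matroid α) (ω : α → ℝ) :
    Matroid.ExchangeProperty (IsTypeBase M ω) := by
  rintro B₁ B₂ ⟨h₁, m₁⟩ ⟨h₂, m₂⟩ e he
  obtain ⟨f, hf, hb, hb'⟩ := exists_symmetric_exchange h₁ h₂ he
  refine ⟨f, hf, hb, fun v hv => (m₁ v hv).trans ?_⟩
  have hsum := congrArg (fun v => ω ⬝ᵥ v) (incidenceVector_exchange he hf)
  simp only [dotProduct_add] at hsum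
  have := m₂ _ (subset_convexHull ℝ _ ⟨_, hb', rfl⟩)
  linarith

/-- The matroid type `M_ω`. -/
def matroidType (M : Matroid α) (ω : α → ℝ) : Matroid α :=
  Matroid.ofIsBaseOfFinite (E := M.E) (Set.toFinite _) (IsTypeBase M ω)
    (exists_isTypeBase M ω) (isTypeBase_exchange M ω) (fun _ h => h.1.subset_ground)

/-- The closed cone spanned by the weight vectors that induce the same matroid type as `ω`. -/
def typeCone (M : Matroid α) (ω : α → ℝ) : Set (α → ℝ) :=
  closure {ω' | matroidType M ω' = matroidType M ω}

/-- The Bergman fan of `M`, as a set of cones: the cones of the normal fan of the matroid polytope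
whose induced matroid type is loopfree. -/
def bergmanFan (M : Matroid α) : Set (Set (α → ℝ)) :=
  {σ | ∃ ω : α → ℝ, (matroidType M ω).Loopless ∧ σ = typeCone M ω}

end Matroid

end DecompositionFan

end

open Set

namespace DecompositionFan

section Matroid

/-! ### Bases that span flats, and decompositions. -/

variable {α : Type*} {M : Matroid α}

/-! Both sides equal the set of weights whose matroid type is loopfree. If `M_ω` is loopfree, an
exchange argument shows that the superlevel sets of `ω` are flats; they form a chain, and `ω` is a
constant plus a nonnegative combination of their incidence vectors. Conversely, a base `B` maximizes
`e_F` as soon as `B ∩ F` spans `F`. The key point, `IsDecomposition.subset_closure_inter`, is that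
this spanning property passes to the middle of a decomposition, hence from a chain `C` to all of
`⟨C⟩`. So a base spanning every flat of `C` maximizes all of `Γ(⟨C⟩)`, and such a base can be chosen
through any given element. -/

/-- If a base spans the outer flats `x` and `y` of a decomposition `(x, z, y)`, then it spans the
middle flat `z`. -/
theorem IsDecomposition.subset_closure_inter {x z y : Flats M} (h : IsDecomposition x z y)
    (hE : M.E = univ) {B : Set α} (hx : x.1 ⊆ M.closure (B ∩ x.1))
    (hy : y.1 ⊆ M.closure (B ∩ y.1)) : z.1 ⊆ M.closure (B ∩ z.1) := by
  obtain ⟨hxz, hzy, ψ, h₁, h₂⟩ := h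
  have hgr : ∀ X : Set α, X ⊆ M.E := fun X => hE ▸ subset_univ X
  have closure_le : ∀ {X : Set α} {F : Flats M}, X ⊆ F.1 → M.closure X ⊆ F.1 :=
    fun {X F} hX => F.2.closure ▸ M.closure_subset_closure hX
  let Z : Flats M := ⟨M.closure (B ∩ z.1), M.isFlat_closure _⟩
  have hxZ : x ≤ Z := hx.trans (M.closure_subset_closure (inter_subset_inter_right _ hxz))
  have hZz : Z ≤ z := closure_le inter_subset_right
  let Z' : Icc x z := ⟨Z, hxZ, hZz⟩
  let x' : Icc x z := ⟨x, le_rfl, hxz⟩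
  let zl : Icc x z := ⟨z, hxz, le_rfl⟩
  let zr : Icc z y := ⟨z, le_rfl, hzy⟩
  let y' : Icc z y := ⟨y, hzy, le_rfl⟩
  have hZψ : Z ≤ (ψ (Z', y')).1 := by
    have : ψ (Z', zr) ≤ ψ (Z', y') := ψ.monotone ⟨le_rfl, hzy⟩
    exact (h₁ Z').symm.le.trans this
  have hwψ : (ψ (x', y')).1 ≤ (ψ (Z', y')).1 := ψ.monotone ⟨hxZ, le_rfl⟩
  -- The flat `ψ (x', y')` is a complement of `z` in `[x, y]`. The flat spanned by `x` and `b` is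
  -- some `ψ (s, t)`. If `s = x`, it lies below the complement; otherwise exchange with some `c ∈ s
  -- \ x` puts `b` in `s ≤ z`.
  have hcover : ∀ b ∈ y.1, b ∈ z.1 ∨ b ∈ (ψ (x', y')).1.1 := by
    intro b hb
    by_cases hbx : b ∈ x.1
    · exact Or.inl (hxz hbx)
    let g : Flats M := ⟨M.closure (insert b x.1), M.isFlat_closure _⟩
    have hxg : x ≤ g := (subset_insert b x.1).trans (M.subset_closure _ (hgr _))
    have hbg : b ∈ g.1 := M.subset_closure _ (hgr _) (mem_insert b x.1)
    have hgy : g ≤ y := closure_le (insert_subset hb (hxz.trans hzy))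
    obtain ⟨⟨s, t⟩, hst⟩ := ψ.surjective ⟨g, hxg, hgy⟩
    by_cases hs : s.1 ≤ x
    · right
      have : ψ (s, t) ≤ ψ (x', y') := ψ.monotone ⟨hs, t.2.2⟩
      rw [hst] at this
      exact this hbg
    · left
      obtain ⟨c, hcs, hcx⟩ := not_subset.1 hs
      have hsg : s.1 ≤ g := by
        have : ψ (s, zr) ≤ ψ (s, t) := ψ.monotone ⟨le_rfl, t.2.1⟩
        rw [hst] at this
        exact (h₁ s).symm.le.trans this
      have hbc : b ∈ M.closure (insert c x.1) :=
        (M.closure_exchange ⟨hsg hcs, by rwa [x.2.closure]⟩).1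
      exact s.2.2 (closure_le (insert_subset hcs s.2.1) hbc)
  -- By `hcover` all of `B ∩ y` lies in `ψ (Z', y')`, and `B ∩ y` spans `y`. Since `ψ (zl, y') = y`,
  -- comparing first coordinates then gives `z ≤ Z`.
  have hyψ : y ≤ (ψ (Z', y')).1 := by
    refine Subset.trans hy (closure_le fun b hb => ?_)
    rcases hcover b hb.2 with hbz | hbw
    · exact hZψ (M.subset_closure _ (hgr _) ⟨hb.1, hbz⟩)
    · exact hwψ hbw
  have hle : ψ (zl, y') ≤ ψ (Z', y') := (h₂ y').le.trans hyψ
  exact (ψ.le_iff_le.1 hle).1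

/-- A base spanning all members of `C` spans all members of the closure of `C` with respect to
decompositions. -/
theorem subset_closure_inter_of_mem_decompositionClosure (hE : M.E = univ) {B : Set α}
    {C : Set (Flats M)} (hC : ∀ F ∈ C, F.1 ⊆ M.closure (B ∩ F.1)) {F : Flats M}
    (hF : F ∈ decompositionClosure (maxDecompositionSet (Flats M)) C) :
    F.1 ⊆ M.closure (B ∩ F.1) :=
  hF {F | F.1 ⊆ M.closure (B ∩ F.1)}
    ⟨hC, fun _ _ _ hd hx hy => IsDecomposition.subset_closure_inter hd hE hx hy⟩

theorem subset_decompositionClosure {P : Type*} (G : Set (P × P × P)) (A : Set P) :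
    A ⊆ decompositionClosure G A :=
  subset_sInter fun _ hB => hB.1

theorem atomMap_eq (hE : M.E = univ) (F : Flats M) : atomMap M F = F.1 := by
  ext i
  refine ⟨fun h => h ?_, fun h => ?_⟩
  · exact M.mem_closure_of_mem' rfl (hE ▸ mem_univ i)
  · change M.closure {i} ⊆ F.1
    exact F.2.closure ▸ M.closure_subset_closure (singleton_subset_iff.2 h)

/-- Given a finite chain of flats, every nonloop lies in an independent set spanning each of
them. -/
theorem exists_indep_mem_spanning_of_isChain (hE : M.E = univ) [Finite α] {i : α} (hi : M.Indep {i})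
    (C : Finset (Flats M)) (hC : IsChain (· ≤ ·) (C : Set (Flats M))) :
    ∃ I, M.Indep I ∧ i ∈ I ∧ ∀ F ∈ C, F.1 ⊆ M.closure (I ∩ F.1) := by
  classical
  -- Flats are added by increasing size, so each new `G` contains the earlier ones. Extending `I ∩
  -- G` to a basis of `G` keeps them spanned; if this loses `i`, then `i ∉ G` and `i` can be put
  -- back.
  induction C using Finset.induction_on_max_value (fun F : Flats M => F.1.ncard) with
  | empty => exact ⟨{i}, hi, rfl, by simp⟩
  | insert G C hG hmax ih =>
    rw [Finset.coe_insert] at hC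
    obtain ⟨I, hI, hiI, hIC⟩ := ih (hC.mono (subset_insert _ _))
    have hle : ∀ F ∈ C, F.1 ⊆ G.1 := by
      intro F hF
      rcases hC.total (mem_insert_of_mem _ hF) (mem_insert _ _) with h | h
      · exact h
      · exact (eq_of_subset_of_ncard_le h (hmax F hF)).symm.subset
    obtain ⟨J, hJ, hIJ⟩ := (hI.inter_right G.1).subset_isBasis_of_subset inter_subset_right
      (hE ▸ subset_univ G.1)
    have hspan : ∀ F ∈ insert G C, F.1 ⊆ M.closure (J ∩ F.1) := by
      intro F hF
      rcases Finset.mem_insert.1 hF with rfl | hF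
      · rw [inter_eq_left.2 hJ.subset]
        exact hJ.subset_closure
      · exact (hIC F hF).trans (M.closure_subset_closure
          fun a ha => ⟨hIJ ⟨ha.1, hle F hF ha.2⟩, ha.2⟩)
    by_cases hiG : i ∈ G.1
    · exact ⟨J, hJ.indep, hIJ ⟨hiI, hiG⟩, hspan⟩
    · refine ⟨insert i J, ?_, mem_insert _ _, fun F hF => (hspan F hF).trans
        (M.closure_subset_closure (inter_subset_inter_left _ (subset_insert _ _)))⟩
      refine ((hJ.indep.notMem_closure_iff (hE ▸ mem_univ i)).1 ?_).1
      rwa [hJ.closure_eq_closure, G.2.closure]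

/-! ### Type bases and the support of the Bergman fan. -/

variable [Fintype α]

theorem incidenceVector_dotProduct_incidenceVector (F B : Set α) :
    incidenceVector F ⬝ᵥ incidenceVector B = ((B ∩ F).ncard : ℝ) := by
  classical
  rw [ncard_eq_toFinset_card', toFinset_inter, ← filter_mem_univ_eq_toFinset,
    ← filter_mem_univ_eq_toFinset]
  simp [incidenceVector, dotProduct, indicator, ← ite_and, Finset.sum_boole, Finset.filter_and]

theorem ncard_inter_le_of_subset_closure {B B' F : Set α} (hB : M.Indep B')
    (hF : F ⊆ M.closure (B ∩ F)) : (B' ∩ F).ncard ≤ (B ∩ F).ncard := by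
  rw [← Nat.cast_le (α := ℕ∞), (toFinite _).cast_ncard_eq, (toFinite _).cast_ncard_eq]
  calc (B' ∩ F).encard = M.eRk (B' ∩ F) := (hB.inter_right F).eRk_eq_encard.symm
    _ ≤ M.eRk (M.closure (B ∩ F)) := M.eRk_mono (inter_subset_right.trans hF)
    _ = M.eRk (B ∩ F) := M.eRk_closure_eq _
    _ ≤ (B ∩ F).encard := M.eRk_le_encard _

theorem isTypeBase_iff {ω : α → ℝ} {B : Set α} : IsTypeBase M ω B ↔
    M.IsBase B ∧ ∀ B', M.IsBase B' → ω ⬝ᵥ incidenceVector B' ≤ ω ⬝ᵥ incidenceVector B := by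
  refine and_congr_right fun _ => ⟨fun h B' hB' => h _ (subset_convexHull ℝ _ ⟨B', hB', rfl⟩),
    fun h v hv => ?_⟩
  have hconv : Convex ℝ {v : α → ℝ | ω ⬝ᵥ v ≤ ω ⬝ᵥ incidenceVector B} :=
    convex_halfSpace_le ⟨fun x y => dotProduct_add ω x y, fun c x => dotProduct_smul c ω x⟩ _
  refine convexHull_min ?_ hconv hv
  rintro _ ⟨B', hB', rfl⟩
  exact h B' hB'

theorem matroidType_isBase {ω : α → ℝ} {B : Set α} :
    (matroidType M ω).IsBase B ↔ IsTypeBase M ω B := Iff.rfl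

theorem matroidType_loopless_iff (hE : M.E = univ) {ω : α → ℝ} :
    (matroidType M ω).Loopless ↔ ∀ i, ∃ B, IsTypeBase M ω B ∧ i ∈ B := by
  rw [Matroid.loopless_iff_forall_isNonloop]
  refine ⟨fun h i => (h i (hE ▸ mem_univ i)).exists_mem_isBase, fun h i _ => ?_⟩
  obtain ⟨B, hB, hi⟩ := h i
  exact (matroidType_isBase.2 hB).indep.isNonloop_of_mem hi

theorem isClosed_setOf_isTypeBase (M : Matroid α) (B : Set α) :
    IsClosed {ω | IsTypeBase M ω B} := by
  simp only [isTypeBase_iff, ofPred_and, ofPred_forall]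
  refine isClosed_const.inter (isClosed_iInter fun B' => isClosed_iInter fun _ => ?_)
  exact isClosed_le (by fun_prop) (by fun_prop)

/-- The support of the Bergman fan consists of the weights with loopfree matroid type. -/
theorem sUnion_bergmanFan (hE : M.E = univ) :
    ⋃₀ bergmanFan M = {ω | (matroidType M ω).Loopless} := by
  ext ω
  constructor
  · rintro ⟨_, ⟨ω₀, h₀, rfl⟩, hω⟩
    rw [matroidType_loopless_iff hE] at h₀
    refine (matroidType_loopless_iff hE).2 fun i => ?_
    obtain ⟨B, hB, hi⟩ := h₀ i
    -- Being a type base is a closed condition on the weight, so it survives passing to the closure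
    -- of the cone.
    refine ⟨B, closure_minimal (fun ω' hω' => ?_) (isClosed_setOf_isTypeBase M B) hω, hi⟩
    have hω' : matroidType M ω' = matroidType M ω₀ := hω'
    rwa [mem_ofPred, ← matroidType_isBase, hω', matroidType_isBase]
  · exact fun h => ⟨_, ⟨ω, h, rfl⟩, subset_closure rfl⟩

/-- If the matroid type of `ω` is loopfree, then the superlevel sets of `ω` are flats. -/
theorem isFlat_superlevel (hE : M.E = univ) {ω : α → ℝ} (h : (matroidType M ω).Loopless)
    (t : ℝ) : M.IsFlat {i | t ≤ ω i} := by
  rw [matroidType_loopless_iff hE] at h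
  rw [Matroid.isFlat_iff_closure_eq]
  refine Subset.antisymm (fun e he => ?_) (M.subset_closure _ (hE ▸ subset_univ _))
  by_contra het
  obtain ⟨B, hB, heB⟩ := h e
  rw [isTypeBase_iff] at hB
  -- Otherwise `B \ {e}` would span the superlevel set and hence `e`. Replacing `e` by the heavier
  -- `f` then contradicts the maximality of `B`.
  obtain ⟨f, hft, hf⟩ : ∃ f ∈ {i | t ≤ ω i}, f ∉ M.closure (B \ {e}) := by
    by_contra! hcon
    exact hB.1.indep.notMem_closure_sdiff_of_mem heB
      (M.closure_subset_closure_of_subset_closure hcon he)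
  have hlt : ω e < ω f := (not_le.1 het).trans_le hft
  have hef : f ≠ e := by rintro rfl; exact hlt.false
  have hfB : f ∉ B := fun hfB => hf (M.mem_closure_of_mem' ⟨hfB, hef⟩ (hE ▸ mem_univ f))
  have hle := hB.2 _ (hB.1.exchange_base_of_notMem_closure heB hf (hE ▸ mem_univ f))
  classical
  have hvec : incidenceVector (insert f (B \ {e})) =
      incidenceVector B + Pi.single f (1 : ℝ) - Pi.single e 1 := by
    funext i
    by_cases h1 : i = e
    · subst h1; simp [incidenceVector, indicator, heB, hef.symm]
    · by_cases h2 : i = f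
      · subst h2; simp [incidenceVector, indicator, hfB, h1]
      · simp [incidenceVector, indicator, h1, h2]
  rw [hvec, dotProduct_sub, dotProduct_add] at hle
  simp only [dotProduct_single, mul_one] at hle
  linarith

/-! ### From loopfree types to the cone. -/

/-- Every real number in a finite set is a constant plus a fixed nonnegative combination of
threshold functions. -/
theorem exists_threshold_decomposition (T : Finset ℝ) : ∃ (c : ℝ) (l : ℝ → ℝ), (∀ t, 0 ≤ l t) ∧
    ∀ x ∈ T, x = c + ∑ t ∈ T, l t * (if t ≤ x then 1 else 0) := by
  induction T using Finset.induction_on_max with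
  | empty => exact ⟨0, 0, by simp, by simp⟩
  | insert a T hmax ih =>
    have haT : a ∉ T := fun h => (hmax a h).false
    rcases T.eq_empty_or_nonempty with rfl | hT
    · exact ⟨a, 0, by simp, by simp⟩
    obtain ⟨c, l, hl, hx⟩ := ih
    have hbT := T.max'_mem hT
    have hba := hmax _ hbT
    -- The coefficient of a new maximum is its gap to the previous one; the smallest value is
    -- absorbed in `c`.
    refine ⟨c, Function.update l a (a - T.max' hT), fun t => ?_, fun x hxT => ?_⟩
    · by_cases h : t = a
      · subst h; simpa using hba.le
      · simpa [h] using hl t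
    · have hcongr : ∀ y, ∑ t ∈ T, Function.update l a (a - T.max' hT) t *
          (if t ≤ y then 1 else 0) = ∑ t ∈ T, l t * (if t ≤ y then 1 else 0) := fun y =>
        Finset.sum_congr rfl fun t ht => by
          rw [Function.update_of_ne (ne_of_mem_of_not_mem ht haT)]
      rw [Finset.sum_insert haT, hcongr, Function.update_self]
      rcases Finset.mem_insert.1 hxT with rfl | hxT
      · have hsum : ∑ t ∈ T, l t * (if t ≤ x then (1 : ℝ) else 0) =
            ∑ t ∈ T, l t * (if t ≤ T.max' hT then 1 else 0) :=
          Finset.sum_congr rfl fun t ht => by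
            rw [if_pos (hmax t ht).le, if_pos (T.le_max' t ht)]
        have := hx _ hbT
        rw [hsum, if_pos le_rfl]
        linarith
      · rw [if_neg (hmax x hxT).not_ge, mul_zero, zero_add]
        exact hx x hxT

/-- The chain of superlevel flats already lies in its own closure, so no decomposition is needed
here. -/
theorem mem_cone_of_loopless (hE : M.E = univ) {ω : α → ℝ}
    (h : (matroidType M ω).Loopless) :
    ω ∈ Ici (0 : ℝ) • ⋃₀ complexRealization (maxDecompositionSet (Flats M)) (atomMap M) +
        (Submodule.span ℝ {(1 : α → ℝ)} : Set (α → ℝ)) := by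
  classical
  let F : ℝ → Flats M := fun t => ⟨{i | t ≤ ω i}, isFlat_superlevel hE h t⟩
  have hchain : IsChain (· ≤ ·) (range F) := by
    rintro _ ⟨s, rfl⟩ _ ⟨t, rfl⟩ -
    rcases le_total s t with hst | hst
    · exact Or.inr fun i (hi : t ≤ ω i) => hst.trans hi
    · exact Or.inl fun i (hi : s ≤ ω i) => hst.trans hi
  have hmem : realizationPolytope (atomMap M)
      (decompositionClosure (maxDecompositionSet (Flats M)) (range F)) ∈
        complexRealization (maxDecompositionSet (Flats M)) (atomMap M) :=
    ⟨_, ⟨range F, range_nonempty F, hchain, rfl⟩, rfl⟩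
  have hvec : ∀ t, incidenceVector {i | t ≤ ω i} ∈ (fun x => incidenceVector (atomMap M x)) ''
      decompositionClosure (maxDecompositionSet (Flats M)) (range F) := fun t =>
    ⟨F t, subset_decompositionClosure _ _ ⟨t, rfl⟩, congrArg incidenceVector (atomMap_eq hE (F t))⟩
  obtain ⟨c, l, hl, hdec⟩ := exists_threshold_decomposition (Finset.univ.image ω)
  set T := Finset.univ.image ω
  have hω : ω = ∑ t ∈ T, l t • incidenceVector {i | t ≤ ω i} + c • (1 : α → ℝ) := by
    funext i
    have := hdec (ω i) (Finset.mem_image_of_mem _ (Finset.mem_univ i))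
    simpa [incidenceVector, indicator, add_comm] using this
  have hc : c • (1 : α → ℝ) ∈ (Submodule.span ℝ {(1 : α → ℝ)} : Set (α → ℝ)) :=
    Submodule.smul_mem _ _ (Submodule.mem_span_singleton_self _)
  rw [hω]
  refine add_mem_add ?_ hc
  -- A positive total weight is the scale factor and the center of mass the point of the polytope;
  -- for total weight zero, any point scaled by zero serves.
  rcases (Finset.sum_nonneg fun t _ => hl t : 0 ≤ ∑ t ∈ T, l t).eq_or_lt' with h0 | hpos
  · have hz : ∑ t ∈ T, l t • incidenceVector {i | t ≤ ω i} = 0 :=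
      Finset.sum_eq_zero fun t ht => by
        rw [(Finset.sum_eq_zero_iff_of_nonneg fun t _ => hl t).1 h0 t ht, zero_smul]
    rw [hz]
    exact mem_smul.2 ⟨0, self_mem_Ici, _, ⟨_, hmem, subset_convexHull ℝ _ (hvec 0)⟩,
      zero_smul _ _⟩
  · refine mem_smul.2 ⟨_, hpos.le, _, ⟨_, hmem, T.centerMass_mem_convexHull (fun t _ => hl t) hpos
      fun t _ => hvec t⟩, ?_⟩
    rw [Finset.centerMass, smul_smul, mul_inv_cancel₀ hpos.ne', one_smul]

/-! ### From the cone to loopfree types. -/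

/-- A base that spans `F` maximizes the incidence vector of `F`. -/
theorem dotProduct_incidenceVector_le {B B' F : Set α} (hB : M.Indep B')
    (hF : F ⊆ M.closure (B ∩ F)) :
    incidenceVector F ⬝ᵥ incidenceVector B' ≤ incidenceVector F ⬝ᵥ incidenceVector B := by
  rw [incidenceVector_dotProduct_incidenceVector, incidenceVector_dotProduct_incidenceVector]
  exact_mod_cast ncard_inter_le_of_subset_closure hB hF

theorem loopless_of_mem_cone (hE : M.E = univ) (hM : IsSimpleMatroid M) {ω : α → ℝ}
    (h : ω ∈ Ici (0 : ℝ) • ⋃₀ complexRealization (maxDecompositionSet (Flats M)) (atomMap M) +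
        (Submodule.span ℝ {(1 : α → ℝ)} : Set (α → ℝ))) :
    (matroidType M ω).Loopless := by
  obtain ⟨_, ⟨s, hs, v, ⟨_, ⟨_, ⟨C, -, hC, rfl⟩, rfl⟩, hv⟩, rfl⟩, u, hu, rfl⟩ := h
  obtain ⟨c, rfl⟩ := Submodule.mem_span_singleton.1 hu
  refine (matroidType_loopless_iff hE).2 fun i => ?_
  have hi : M.Indep {i} := by
    simpa using hM i (hE ▸ mem_univ i) i (hE ▸ mem_univ i)
  obtain ⟨I, hI, hiI, hIC⟩ := exists_indep_mem_spanning_of_isChain hE hi (toFinite C).toFinset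
    (by simpa using hC)
  obtain ⟨B, hB, hIB⟩ := hI.exists_isBase_superset
  refine ⟨B, isTypeBase_iff.2 ⟨hB, fun B' hB' => ?_⟩, hIB hiI⟩
  have hspan : ∀ F ∈ C, F.1 ⊆ M.closure (B ∩ F.1) := fun F hF =>
    (hIC F (by simpa using hF)).trans
      (M.closure_subset_closure (inter_subset_inter_left _ hIB))
  have hvB : v ⬝ᵥ incidenceVector B' ≤ v ⬝ᵥ incidenceVector B := by
    have hconv : Convex ℝ {v : α → ℝ |
        v ⬝ᵥ (incidenceVector B' - incidenceVector B) ≤ 0} :=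
      convex_halfSpace_le ⟨fun x y => add_dotProduct x y _, fun c x => smul_dotProduct c x _⟩ _
    have := convexHull_min (t := {v : α → ℝ |
        v ⬝ᵥ (incidenceVector B' - incidenceVector B) ≤ 0}) ?_ hconv hv
    · simpa [dotProduct_sub] using this
    rintro _ ⟨F, hF, rfl⟩
    simp only [mem_ofPred, dotProduct_sub, sub_nonpos, atomMap_eq hE]
    exact dotProduct_incidenceVector_le hB'.indep
      (subset_closure_inter_of_mem_decompositionClosure hE hspan hF)
  -- The all-ones vector is `e_F` for `F = univ`, which every base spans, so it takes the same value
  -- on all bases.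
  have hone : (1 : α → ℝ) ⬝ᵥ incidenceVector B' = (1 : α → ℝ) ⬝ᵥ incidenceVector B := by
    have huniv : (1 : α → ℝ) = incidenceVector univ := by simp [incidenceVector]
    have key : ∀ {B}, M.IsBase B → (univ : Set α) ⊆ M.closure (B ∩ univ) := fun hB => by
      rw [inter_univ, hB.closure_eq, hE]
    rw [huniv]
    exact (dotProduct_incidenceVector_le hB'.indep (key hB)).antisymm
      (dotProduct_incidenceVector_le hB.indep (key hB'))
  simp only [add_dotProduct, smul_dotProduct, hone]
  gcongr

end Matroid

end DecompositionFan

theorem mainTheorem5 {α : Type*} [Fintype α] (M : Matroid α) (hE : M.E = Set.univ)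
    (hM : DecompositionFan.IsSimpleMatroid M) :
    ⋃₀ DecompositionFan.bergmanFan M =
      Set.Ici (0 : ℝ) •
          ⋃₀ DecompositionFan.complexRealization
            (DecompositionFan.maxDecompositionSet (DecompositionFan.Flats M))
            (DecompositionFan.atomMap M) +
        (Submodule.span ℝ {(1 : α → ℝ)} : Set (α → ℝ)) := by
  rw [DecompositionFan.sUnion_bergmanFan hE]
  exact Set.Subset.antisymm (fun _ h => DecompositionFan.mem_cone_of_loopless hE h)
    (fun _ h => DecompositionFan.loopless_of_mem_cone hE hM h)
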